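/- Let $A\in\mathbb{R}^{n\times n}$ be symmetric, let $f$ be a real-valued function (defined on the spectrum of $A$), let $f(A)$ be the corresponding matrix function, and suppose that $f(A)\neq 0$. Let $\mathcal{G}(A)$ be the graph on $\{1,\dots,n\}$ in which $i\ne j$ are adjacent iff $[A]_{ij}\neq 0$, and let $C_1,\dots,C_m$ be the color classes of a distance-$d$ coloring of $\mathcal{G}(A)$, i.e. a partition of $\{1,\dots,n\}$ such that two distinct indices at geodesic distance at most $d$ never lie in the same class. Let $N_1,\dots,N_m$ be positive integers. For $\ell=1,\dots,m$ and $s=1,\dots,N_\ell$ let $w_\ell^{(s)}=\sum_{i\in C_\ell}X_{\ell,s,i}\,e_i$, where all the $X_{\ell,s,i}$ are independent random variables with values $\pm1$ taken with probability $\tfrac12$ each, and let $$T:=\sum_{\ell=1}^m\frac1{N_\ell}\sum_{s=1}^{N_\ell}(w_\ell^{(s)})^T f(A)\,w_\ell^{(s)}$$ be the stochastic probing estimator of $\operatorname{tr} f(A)$. Write $[M]_{C}$ for the submatrix of $M$ with row and column indices in $C$, $\operatorname{Off}(B)$ for the off-diagonal part of $B$, $\|\cdot\|_F$ and $\|\cdot\|_2$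 for the Frobenius and the spectral norm, and put $$\eta_1:=\sum_{\ell=1}^m\frac1{N_\ell}\|\operatorname{Off}([f(A)]_{C_\ell})\|_F^2,\qquad \eta_2:=\max_{\ell=1,\dots,m}\frac1{N_\ell}\|\operatorname{Off}([f(A)]_{C_\ell})\|_2 .$$ Then $\eta_1=\frac12\sum_{\ell=1}^m V_\ell/N_\ell$, where $V_\ell$ is the variance of $(w_\ell^{(s)})^T f(A)\,w_\ell^{(s)}$ (for any $s$), and for every $\varepsilon>0$ $$\mathbb{P}\bigl(|\operatorname{tr} f(A)-T|\ge\varepsilon\bigr)\le 2\exp\Bigl(-\frac{\varepsilon^2}{8\eta_1+8\varepsilon\eta_2}\Bigr),$$ where the right-hand side is read as $0$ if $\eta_1=\eta_2=0$. In particular, if $0<\delta\le1$ and $\eta_1+\varepsilon\eta_2\le\dfrac{\varepsilon^2}{8\log(2/\delta)}$, then $\mathbb{P}\bigl(|\operatorname{tr} f(A)-T|\ge\varepsilon\bigr)\le\delta$. -/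

import Mathlib

open MeasureTheory ProbabilityTheory
open scoped ENNReal Matrix

namespace StochasticProbing

/-- The undirected graph `𝒢(A)` of a symmetric matrix `A`: distinct `i`, `j` are adjacent iff
`A i j ≠ 0`. -/
def matrixGraph {n : ℕ} (A : Matrix (Fin n) (Fin n) ℝ) (hA : A.IsSymm) : SimpleGraph (Fin n) where
  Adj i j := i ≠ j ∧ A i j ≠ 0
  symm := ⟨fun i j h => ⟨h.1.symm, by rw [hA.apply i j]; exact h.2⟩⟩
  loopless := ⟨fun _ h => h.1 rfl⟩

/-- `col : V → {1, …, m}` is a distance-`d` coloring of `G`: distinct vertices at geodesic distance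
at most `d` get different colors. The distance is the extended one, so that vertices in different
connected components are at distance `⊤`. -/
def IsDistanceColoring {V : Type*} {m : ℕ} (G : SimpleGraph V) (d : ℕ) (col : V → Fin m) : Prop :=
  ∀ i j : V, i ≠ j → G.edist i j ≤ (d : ℕ∞) → col i ≠ col j

/-- The color class `C_ℓ = {i : col i = ℓ}`, as a type. -/
abbrev ColorClass {n m : ℕ} (col : Fin n → Fin m) (ℓ : Fin m) : Type := {i : Fin n // col i = ℓ}

/-- The submatrix `[M]_{C_ℓ}` of the rows and columns with index in `C_ℓ`. -/
def colorBlock {n m : ℕ} (M : Matrix (Fin n) (Fin n) ℝ) (col : Fin n → Fin m) (ℓ : Fin m) :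
    Matrix (ColorClass col ℓ) (ColorClass col ℓ) ℝ :=
  M.submatrix Subtype.val Subtype.val

/-- The off-diagonal part `Off(B)` of a square matrix. -/
def offDiag {ι : Type*} [DecidableEq ι] (B : Matrix ι ι ℝ) : Matrix ι ι ℝ :=
  B - Matrix.diagonal B.diag

/-- The Frobenius norm `‖B‖_F`. -/
noncomputable def frobNorm {ι : Type*} [Fintype ι] (B : Matrix ι ι ℝ) : ℝ :=
  letI : NormedAddCommGroup (Matrix ι ι ℝ) := Matrix.frobeniusNormedAddCommGroup
  ‖B‖

/-- The spectral norm `‖B‖₂`, the operator norm for the Euclidean vector norm. -/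
noncomputable def specNorm {ι : Type*} [Fintype ι] [DecidableEq ι] (B : Matrix ι ι ℝ) : ℝ :=
  ‖Matrix.toEuclideanCLM (n := ι) (𝕜 := ℝ) B‖

/-- The law of a Rademacher variable: the values `1` and `-1`, each with probability `1/2`. -/
noncomputable def rademacher : Measure ℝ :=
  (2⁻¹ : ℝ≥0∞) • (Measure.dirac (1 : ℝ) + Measure.dirac (-1 : ℝ))

/-- The random variables `X i` are i.i.d. Rademacher variables. -/
structure IsRademacherFamily {ι Ω : Type*} [MeasurableSpace Ω] (X : ι → Ω → ℝ) (μ : Measure Ω) :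
    Prop where
  hasLaw : ∀ i, HasLaw (X i) rademacher μ
  indep : iIndepFun X μ

/-- The index set of the random signs that are drawn: the color `ℓ`, the number `s` of the sample
for that color, and the index `i ∈ C_ℓ`. -/
abbrev SignIndex {n m : ℕ} (col : Fin n → Fin m) (N : Fin m → ℕ) : Type :=
  Σ ℓ : Fin m, Fin (N ℓ) × ColorClass col ℓ

/-- The probing vector `w_ℓ^(s) = ∑_{i ∈ C_ℓ} x_{ℓ,s,i} e_i`. -/
def probingVector {n m : ℕ} (col : Fin n → Fin m) (N : Fin m → ℕ) (x : SignIndex col N → ℝ)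
    (ℓ : Fin m) (s : Fin (N ℓ)) : Fin n → ℝ :=
  ∑ i : ColorClass col ℓ, x ⟨ℓ, s, i⟩ • Pi.single (i : Fin n) (1 : ℝ)

/-- The quadratic form `(w_ℓ^(s))ᵀ M w_ℓ^(s)`. -/
def probingForm {n m : ℕ} (M : Matrix (Fin n) (Fin n) ℝ) (col : Fin n → Fin m) (N : Fin m → ℕ)
    (x : SignIndex col N → ℝ) (ℓ : Fin m) (s : Fin (N ℓ)) : ℝ :=
  probingVector col N x ℓ s ⬝ᵥ M *ᵥ probingVector col N x ℓ s

/-- The stochastic probing estimator `∑_ℓ (1 / N_ℓ) ∑_s (w_ℓ^(s))ᵀ M w_ℓ^(s)` of `tr M`. -/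
noncomputable def probingEstimator {n m : ℕ} (M : Matrix (Fin n) (Fin n) ℝ) (col : Fin n → Fin m)
    (N : Fin m → ℕ) (x : SignIndex col N → ℝ) : ℝ :=
  ∑ ℓ : Fin m, (1 / (N ℓ : ℝ)) * ∑ s : Fin (N ℓ), probingForm M col N x ℓ s

/-- `η₁ = ∑_ℓ ‖Off([M]_{C_ℓ})‖_F² / N_ℓ`. -/
noncomputable def etaOne {n m : ℕ} (M : Matrix (Fin n) (Fin n) ℝ) (col : Fin n → Fin m)
    (N : Fin m → ℕ) : ℝ :=
  ∑ ℓ : Fin m, (1 / (N ℓ : ℝ)) * frobNorm (offDiag (colorBlock M col ℓ)) ^ 2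

/-- `η₂ = max_ℓ ‖Off([M]_{C_ℓ})‖₂ / N_ℓ`, a maximum over the finitely many colors. -/
noncomputable def etaTwo {n m : ℕ} (M : Matrix (Fin n) (Fin n) ℝ) (col : Fin n → Fin m)
    (N : Fin m → ℕ) : ℝ :=
  ⨆ ℓ : Fin m, (1 / (N ℓ : ℝ)) * specNorm (offDiag (colorBlock M col ℓ))

end StochasticProbing

/-!
Off an event of probability zero, the error of the estimator is, up to sign, a single Rademacher
chaos `xᵀ B x`, where `B` is block diagonal with zero diagonal, `‖B‖_F² = η₁` and `‖B‖₂ ≤ η₂`. The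
entries `xᵢ xⱼ` with `i ≠ j` are orthonormal up to the symmetry `xᵢ xⱼ = xⱼ xᵢ`, which gives the
variance of each form.

Since `B` has zero diagonal, `xᵀ B x` is affine in each coordinate, so `cosh b ≤ exp (b² / 2)` shows
that replacing the signs one at a time by standard Gaussians can only increase
`𝔼 exp (t xᵀ B x)`. The Gaussian chaos is diagonalized by a rotation, and its moment generating
function is `∏ (1 - 2 t λᵢ)^(-1/2)` for the eigenvalues `λᵢ` of `B`. As `∑ λᵢ = tr B = 0` and
`∑ λᵢ² = ‖B‖_F²`, this is at most `exp (2 η₁ t² / (1 - 2 η₂ t))`, and Chernoff's bound yields the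
tail estimate.
-/

namespace StochasticProbing

section ProductMeasure

variable {ι : Type*} [Fintype ι] {α : ι → Type*} [∀ i, MeasurableSpace (α i)]

lemma lintegral_pi_update_le [DecidableEq ι] {μ : ∀ i, Measure (α i)} [∀ i, SigmaFinite (μ i)]
    {i : ι} {ρ : Measure (α i)} [SigmaFinite ρ] {f : (∀ i, α i) → ℝ≥0∞} (hf : Measurable f)
    (h : ∀ x, ∫⁻ t, f (Function.update x i t) ∂ρ ≤ ∫⁻ t, f (Function.update x i t) ∂μ i) :
    ∫⁻ x, f x ∂Measure.pi (Function.update μ i ρ) ≤ ∫⁻ x, f x ∂Measure.pi μ := by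
  have : ∀ j, SigmaFinite (Function.update μ i ρ j) := by
    intro j
    obtain rfl | hj := eq_or_ne j i
    · rwa [Function.update_self]
    · rw [Function.update_of_ne hj]
      infer_instance
  have erase_update : ∀ g, lmarginal (Function.update μ i ρ) (Finset.univ.erase i) g
      = lmarginal μ (Finset.univ.erase i) g := by
    have hμ : (fun j : (Finset.univ.erase i : Finset ι) => Function.update μ i ρ j)
        = fun j : (Finset.univ.erase i : Finset ι) => μ j :=
      funext fun j => Function.update_of_ne (Finset.ne_of_mem_erase j.2) _ _
    intro g
    funext y
    rw [lmarginal, lmarginal, hμ]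
  cases isEmpty_or_nonempty (∀ i, α i) with
  | inl _ => simp only [lintegral_of_isEmpty, le_refl]
  | inr hα =>
    obtain ⟨x₀⟩ := hα
    rw [lintegral_eq_lmarginal_univ x₀, lintegral_eq_lmarginal_univ x₀,
      lmarginal_erase' f hf (Finset.mem_univ i), lmarginal_erase' f hf (Finset.mem_univ i),
      erase_update, Function.update_self]
    exact lmarginal_mono h x₀

lemma lintegral_pi_mono_of_update [DecidableEq ι] {ρ μ : ∀ i, Measure (α i)}
    [∀ i, SigmaFinite (ρ i)] [∀ i, SigmaFinite (μ i)] {f : (∀ i, α i) → ℝ≥0∞} (hf : Measurable f)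
    (h : ∀ i x, ∫⁻ t, f (Function.update x i t) ∂ρ i ≤ ∫⁻ t, f (Function.update x i t) ∂μ i) :
    ∫⁻ x, f x ∂Measure.pi ρ ≤ ∫⁻ x, f x ∂Measure.pi μ := by
  suffices ∀ s : Finset ι, ∫⁻ x, f x ∂Measure.pi (s.piecewise ρ μ) ≤ ∫⁻ x, f x ∂Measure.pi μ by
    simpa only [Finset.piecewise_univ] using this Finset.univ
  intro s
  induction s using Finset.induction_on with
  | empty => rw [Finset.piecewise_empty]
  | insert i s hi ih =>
    have : ∀ j, SigmaFinite (s.piecewise ρ μ j) := fun j =>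
      s.piecewise_cases ρ μ SigmaFinite inferInstance inferInstance
    rw [Finset.piecewise_insert]
    refine (lintegral_pi_update_le hf fun x => ?_).trans ih
    rw [Finset.piecewise_eq_of_notMem _ _ _ hi]
    exact h i x

lemma lintegral_pi_prod {μ : ∀ i, Measure (α i)} [∀ i, IsProbabilityMeasure (μ i)]
    {f : ∀ i, α i → ℝ≥0∞} (hf : ∀ i, Measurable (f i)) :
    ∫⁻ x, ∏ i, f i (x i) ∂Measure.pi μ = ∏ i, ∫⁻ t, f i t ∂μ i := by
  rw [lintegral_prod_eq_prod_lintegral_of_indepFun Finset.univ (fun i (x : ∀ i, α i) => f i (x i))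
    (iIndepFun_pi fun i => (hf i).aemeasurable) fun i => (hf i).comp (measurable_pi_apply i)]
  exact Finset.prod_congr rfl fun i _ => (measurePreserving_eval μ i).lintegral_comp (hf i)

end ProductMeasure

section QuadraticForm

variable {ι : Type*} [Fintype ι]

lemma dotProduct_mulVec_update [DecidableEq ι] {R : Type*} [CommSemiring R] {B : Matrix ι ι R}
    {i : ι} (hB : B i i = 0) (x : ι → R) (t : R) :
    Function.update x i t ⬝ᵥ B *ᵥ Function.update x i t
      = Function.update x i 0 ⬝ᵥ B *ᵥ Function.update x i 0
        + t * ((Function.update x i 0 ᵥ* B) i + (B *ᵥ Function.update x i 0) i) := by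
  have hu : Function.update x i t = Function.update x i 0 + t • Pi.single i 1 := by
    funext j
    obtain rfl | hj := eq_or_ne j i
    · simp
    · simp [hj]
  have hi : (Pi.single i 1 ᵥ* B) i = 0 := by simp [hB]
  rw [hu]
  simp only [Matrix.mulVec_add, Matrix.mulVec_smul, dotProduct_add, add_dotProduct,
    dotProduct_smul, smul_dotProduct, smul_eq_mul, single_one_dotProduct,
    Matrix.dotProduct_mulVec _ B (Pi.single i 1), dotProduct_single_one, Matrix.add_vecMul,
    Matrix.smul_vecMul, Pi.add_apply, Pi.smul_apply, hi]
  ring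

lemma measurable_dotProduct_mulVec (B : Matrix ι ι ℝ) :
    Measurable fun x : ι → ℝ => x ⬝ᵥ B *ᵥ x := by
  simp only [dotProduct, Matrix.mulVec]
  fun_prop

lemma dotProduct_mulVec_eq_sum {R : Type*} [CommSemiring R] (B : Matrix ι ι R) (x : ι → R) :
    x ⬝ᵥ B *ᵥ x = ∑ p : ι × ι, B p.1 p.2 * (x p.1 * x p.2) := by
  simp only [dotProduct, Matrix.mulVec, Finset.mul_sum, Fintype.sum_prod_type]
  exact Finset.sum_congr rfl fun i _ => Finset.sum_congr rfl fun j _ => by ring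

variable [DecidableEq ι] {B : Matrix ι ι ℝ}

lemma eigenvectorBasis_dotProduct_eigenvectorBasis (hB : B.IsHermitian) (i j : ι) :
    (hB.eigenvectorBasis i).ofLp ⬝ᵥ (hB.eigenvectorBasis j).ofLp = if i = j then 1 else 0 := by
  have h := orthonormal_iff_ite.1 hB.eigenvectorBasis.orthonormal i j
  rwa [EuclideanSpace.inner_eq_star_dotProduct, star_trivial, dotProduct_comm] at h

lemma eigenvalues_le_of_dotProduct_mulVec_le (hB : B.IsHermitian) {κ : ℝ}
    (hκ : ∀ x : ι → ℝ, x ⬝ᵥ B *ᵥ x ≤ κ * (x ⬝ᵥ x)) (i : ι) : hB.eigenvalues i ≤ κ := by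
  simpa only [hB.mulVec_eigenvectorBasis, dotProduct_smul, smul_eq_mul,
    eigenvectorBasis_dotProduct_eigenvectorBasis, if_true, mul_one]
    using hκ (hB.eigenvectorBasis i).ofLp

lemma sum_sq_eigenvalues (hB : B.IsHermitian) :
    ∑ i, hB.eigenvalues i ^ 2 = ∑ i, ∑ j, B i j ^ 2 := by
  have htrace : (B * B).trace = ∑ i, ∑ j, B i j ^ 2 := by
    simp only [Matrix.trace, Matrix.diag, Matrix.mul_apply]
    refine Finset.sum_congr rfl fun i _ => Finset.sum_congr rfl fun j _ => ?_
    rw [← hB.apply j i, star_trivial, sq]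
  rw [← htrace]
  conv_rhs => rw [hB.spectral_theorem, ← map_mul, Unitary.conjStarAlgAut_apply,
    Matrix.trace_mul_cycle]
  simp [Matrix.trace, sq]

lemma dotProduct_mulVec_sum_eigenvectorBasis (hB : B.IsHermitian) (y : ι → ℝ) :
    (∑ i, y i • hB.eigenvectorBasis i).ofLp ⬝ᵥ B *ᵥ (∑ i, y i • hB.eigenvectorBasis i).ofLp
      = ∑ i, hB.eigenvalues i * y i ^ 2 := by
  simp only [WithLp.ofLp_sum, WithLp.ofLp_smul, Matrix.mulVec_sum, Matrix.mulVec_smul,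
    hB.mulVec_eigenvectorBasis, sum_dotProduct, dotProduct_sum, smul_dotProduct, dotProduct_smul,
    eigenvectorBasis_dotProduct_eigenvectorBasis, smul_eq_mul, mul_ite, mul_one, mul_zero,
    Finset.sum_ite_eq', Finset.mem_univ, if_true]
  exact Finset.sum_congr rfl fun i _ => by ring

end QuadraticForm

section GaussianChaos

lemma lintegral_exp_mul_sq_gaussianReal {b : ℝ} (hb : 2 * b < 1) :
    ∫⁻ t, ENNReal.ofReal (Real.exp (b * t ^ 2)) ∂gaussianReal 0 1
      = ENNReal.ofReal (√(1 - 2 * b))⁻¹ := by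
  have hb' : 0 < 1 / 2 - b := by linarith
  have hdensity : ∀ t : ℝ, (gaussianPDF 0 1 * fun t => ENNReal.ofReal (Real.exp (b * t ^ 2))) t
      = ENNReal.ofReal ((√(2 * Real.pi))⁻¹ * Real.exp (-(1 / 2 - b) * t ^ 2)) := by
    intro t
    rw [Pi.mul_apply, gaussianPDF, ← ENNReal.ofReal_mul (gaussianPDFReal_nonneg _ _ _),
      gaussianPDFReal, mul_assoc, ← Real.exp_add]
    congr 3 <;> norm_num
    ring
  rw [gaussianReal_of_var_ne_zero _ one_ne_zero,
    lintegral_withDensity_eq_lintegral_mul _ (measurable_gaussianPDF 0 1) (by fun_prop)]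
  simp_rw [hdensity]
  rw [← ofReal_integral_eq_lintegral_ofReal ((integrable_exp_neg_mul_sq hb').const_mul _)
    (ae_of_all _ fun _ => by positivity), integral_const_mul, integral_gaussian,
    ← Real.sqrt_inv, ← Real.sqrt_inv, ← Real.sqrt_mul (by positivity)]
  congr 2
  have := Real.pi_pos.ne'
  have : 1 - 2 * b ≠ 0 := by linarith
  field_simp

lemma inv_sqrt_one_sub_two_mul_le_exp {b κ : ℝ} (hb : b ≤ κ) (hκ : 2 * κ < 1) :
    (√(1 - 2 * b))⁻¹ ≤ Real.exp (b + 2 * b ^ 2 / (1 - 2 * κ)) := by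
  have hpos : 0 < 1 - 2 * b := by linarith
  rw [← Real.sqrt_inv, Real.sqrt_eq_rpow, ← Real.exp_log (inv_pos.2 hpos), ← Real.exp_mul,
    Real.exp_le_exp]
  calc Real.log (1 - 2 * b)⁻¹ * (1 / 2)
      ≤ ((1 - 2 * b)⁻¹ - 1) * (1 / 2) := by
        gcongr
        exact Real.log_le_sub_one_of_pos (inv_pos.2 hpos)
    _ = b + 2 * b ^ 2 / (1 - 2 * b) := by
        field_simp
        ring
    _ ≤ b + 2 * b ^ 2 / (1 - 2 * κ) := by gcongr

variable {ι : Type*} [Fintype ι] {B : Matrix ι ι ℝ}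

lemma lintegral_exp_dotProduct_mulVec_gaussianReal [DecidableEq ι] (hB : B.IsHermitian) :
    ∫⁻ x, ENNReal.ofReal (Real.exp (x ⬝ᵥ B *ᵥ x)) ∂Measure.pi (fun _ : ι => gaussianReal 0 1)
      = ∏ i, ∫⁻ t, ENNReal.ofReal (Real.exp (hB.eigenvalues i * t ^ 2)) ∂gaussianReal 0 1 := by
  have hmeas : Measurable fun x : EuclideanSpace ℝ ι =>
      ENNReal.ofReal (Real.exp (x.ofLp ⬝ᵥ B *ᵥ x.ofLp)) :=
    ((measurable_dotProduct_mulVec B).comp (by fun_prop)).exp.ennreal_ofReal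
  calc ∫⁻ x, ENNReal.ofReal (Real.exp (x ⬝ᵥ B *ᵥ x)) ∂Measure.pi (fun _ : ι => gaussianReal 0 1)
      = ∫⁻ x, ENNReal.ofReal (Real.exp (x.ofLp ⬝ᵥ B *ᵥ x.ofLp))
          ∂stdGaussian (EuclideanSpace ℝ ι) := by
        rw [← map_pi_eq_stdGaussian, lintegral_map hmeas (by fun_prop)]
    _ = ∫⁻ y, ENNReal.ofReal (Real.exp (∑ i, hB.eigenvalues i * y i ^ 2))
          ∂Measure.pi (fun _ : ι => gaussianReal 0 1) := by
        rw [stdGaussian_eq_map_pi_orthonormalBasis hB.eigenvectorBasis,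
          lintegral_map hmeas (by fun_prop)]
        simp_rw [dotProduct_mulVec_sum_eigenvectorBasis hB]
    _ = _ := by
        simp_rw [Real.exp_sum, ENNReal.ofReal_prod_of_nonneg fun _ _ => (Real.exp_pos _).le]
        exact lintegral_pi_prod
          (f := fun i t => ENNReal.ofReal (Real.exp (hB.eigenvalues i * t ^ 2)))
          fun i => by fun_prop

lemma lintegral_exp_dotProduct_mulVec_gaussianReal_le (hB : B.IsHermitian) {κ : ℝ}
    (hκB : ∀ x : ι → ℝ, x ⬝ᵥ B *ᵥ x ≤ κ * (x ⬝ᵥ x)) (hκ : 2 * κ < 1) :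
    ∫⁻ x, ENNReal.ofReal (Real.exp (x ⬝ᵥ B *ᵥ x)) ∂Measure.pi (fun _ : ι => gaussianReal 0 1)
      ≤ ENNReal.ofReal (Real.exp (B.trace + 2 * (∑ i, ∑ j, B i j ^ 2) / (1 - 2 * κ))) := by
  classical
  have hle := eigenvalues_le_of_dotProduct_mulVec_le hB hκB
  have hfactor : ∀ i,
      ∫⁻ t, ENNReal.ofReal (Real.exp (hB.eigenvalues i * t ^ 2)) ∂gaussianReal 0 1
        ≤ ENNReal.ofReal (Real.exp
            (hB.eigenvalues i + 2 * hB.eigenvalues i ^ 2 / (1 - 2 * κ))) := by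
    intro i
    rw [lintegral_exp_mul_sq_gaussianReal (by linarith [hle i])]
    exact ENNReal.ofReal_le_ofReal (inv_sqrt_one_sub_two_mul_le_exp (hle i) hκ)
  have htrace : B.trace = ∑ i, hB.eigenvalues i := hB.trace_eq_sum_eigenvalues
  rw [lintegral_exp_dotProduct_mulVec_gaussianReal hB]
  refine (Finset.prod_le_prod' fun i _ => hfactor i).trans_eq ?_
  rw [← ENNReal.ofReal_prod_of_nonneg fun _ _ => (Real.exp_pos _).le, ← Real.exp_sum,
    Finset.sum_add_distrib, ← Finset.sum_div, ← Finset.mul_sum, sum_sq_eigenvalues, htrace]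

end GaussianChaos

section SubgammaMGF

variable {Ω : Type*} [MeasurableSpace Ω] {μ : Measure Ω} {Y : Ω → ℝ} {v c : ℝ}

/-- `Y` is sub-gamma on the right with variance factor `v` and scale factor `c`: its moment
generating function at `0 ≤ t < 1 / c` is at most `exp (v t² / (2 (1 - c t)))`. The range of `t` is
written as `c * t < 1`, so that it is the whole half-line for `c = 0`. -/
structure HasSubgammaMGF (Y : Ω → ℝ) (v c : ℝ) (μ : Measure Ω) : Prop where
  integrable_exp_mul : ∀ t, 0 ≤ t → c * t < 1 → Integrable (fun ω => Real.exp (t * Y ω)) μ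
  mgf_le : ∀ t, 0 ≤ t → c * t < 1 → mgf Y μ t ≤ Real.exp (v * t ^ 2 / (2 * (1 - c * t)))

namespace HasSubgammaMGF

variable [IsFiniteMeasure μ]

lemma measureReal_ge_le_exp_add (h : HasSubgammaMGF Y v c μ) (ε : ℝ) {t : ℝ} (ht : 0 ≤ t)
    (hct : c * t < 1) :
    μ.real {ω | ε ≤ Y ω} ≤ Real.exp (-t * ε + v * t ^ 2 / (2 * (1 - c * t))) := by
  rw [Real.exp_add]
  exact (measure_ge_le_exp_mul_mgf ε ht (h.integrable_exp_mul t ht hct)).trans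
    (mul_le_mul_of_nonneg_left (h.mgf_le t ht hct) (Real.exp_pos _).le)

lemma measureReal_ge_le (h : HasSubgammaMGF Y v c μ) (hv : 0 ≤ v) (hc : 0 ≤ c) {ε : ℝ}
    (hε : 0 ≤ ε) (hD : 0 < v + c * ε) :
    μ.real {ω | ε ≤ Y ω} ≤ Real.exp (-(ε ^ 2 / (2 * (v + c * ε)))) := by
  obtain rfl | hv := hv.eq_or_lt
  · have hcε : 0 < c * ε := by simpa using hD
    have hc : 0 < c := pos_of_mul_pos_left hcε hε
    have hct : c * (1 / (2 * c)) < 1 := by field_simp; norm_num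
    refine (h.measureReal_ge_le_exp_add ε (by positivity) hct).trans_eq (congrArg Real.exp ?_)
    field_simp
    ring
  · have hct : 1 - c * (ε / (v + c * ε)) = v / (v + c * ε) := by field_simp; ring
    have := div_pos hv hD
    refine (h.measureReal_ge_le_exp_add ε (t := ε / (v + c * ε)) (by positivity)
      (by linarith)).trans_eq (congrArg Real.exp ?_)
    rw [hct]
    field_simp
    ring

lemma measureReal_abs_ge_le (h : HasSubgammaMGF Y v c μ) (h' : HasSubgammaMGF (-Y) v c μ)
    (hv : 0 ≤ v) (hc : 0 ≤ c) {ε : ℝ} (hε : 0 ≤ ε) (hD : 0 < v + c * ε) :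
    μ.real {ω | ε ≤ |Y ω|} ≤ 2 * Real.exp (-(ε ^ 2 / (2 * (v + c * ε)))) := by
  simp_rw [le_abs, Set.ofPred_or]
  rw [two_mul (Real.exp _)]
  exact (measureReal_union_le _ _).trans
    (add_le_add (h.measureReal_ge_le hv hc hε hD) (h'.measureReal_ge_le hv hc hε hD))

end HasSubgammaMGF

end SubgammaMGF

section Rademacher

lemma lintegral_rademacher {f : ℝ → ℝ≥0∞} (hf : Measurable f) :
    ∫⁻ t, f t ∂rademacher = 2⁻¹ * (f 1 + f (-1)) := by
  simp [rademacher, lintegral_dirac' _ hf, mul_add]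

instance isProbabilityMeasure_rademacher : IsProbabilityMeasure rademacher := ⟨by
  rw [← lintegral_one, lintegral_rademacher measurable_const, one_add_one_eq_two]
  exact ENNReal.inv_mul_cancel (by simp) (by simp)⟩

lemma ae_rademacher : ∀ᵐ t ∂rademacher, t = 1 ∨ t = -1 := by
  have hmeas : MeasurableSet {t : ℝ | t = 1 ∨ t = -1} := by measurability
  rw [rademacher, Measure.ae_ennreal_smul_measure_iff (by simp), ae_add_measure_iff,
    ae_dirac_iff hmeas, ae_dirac_iff hmeas]
  simp

lemma integral_pow_rademacher (e : ℕ) :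
    ∫ t, t ^ e ∂rademacher = if Even e then 1 else 0 := by
  rw [rademacher, integral_smul_measure, integral_add_measure (integrable_dirac (by simp))
    (integrable_dirac (by simp)), integral_dirac, integral_dirac, one_pow]
  split_ifs with he
  · norm_num [he.neg_one_pow]
  · norm_num [(Nat.not_even_iff_odd.1 he).neg_one_pow]

lemma lintegral_exp_add_mul_rademacher (a b : ℝ) :
    ∫⁻ t, ENNReal.ofReal (Real.exp (a + t * b)) ∂rademacher
      = ENNReal.ofReal (Real.exp a * Real.cosh b) := by
  have htwo : (2 : ℝ≥0∞)⁻¹ = ENNReal.ofReal 2⁻¹ := by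
    rw [ENNReal.ofReal_inv_of_pos two_pos, ENNReal.ofReal_ofNat]
  rw [lintegral_rademacher (by fun_prop), ← ENNReal.ofReal_add (by positivity) (by positivity),
    htwo, ← ENNReal.ofReal_mul (by positivity), Real.cosh_eq, Real.exp_add, Real.exp_add, one_mul,
    neg_one_mul]
  congr 1
  ring

lemma lintegral_exp_add_mul_gaussianReal (a b : ℝ) :
    ∫⁻ t, ENNReal.ofReal (Real.exp (a + t * b)) ∂gaussianReal 0 1
      = ENNReal.ofReal (Real.exp a * Real.exp (b ^ 2 / 2)) := by
  have hmgf : ∫ t, Real.exp (b * t) ∂gaussianReal 0 1 = Real.exp (b ^ 2 / 2) := by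
    simpa only [mgf, id, zero_mul, zero_add, NNReal.coe_one, one_mul]
      using congrFun (mgf_id_gaussianReal (μ := 0) (v := 1)) b
  simp_rw [Real.exp_add, mul_comm _ b]
  rw [← ofReal_integral_eq_lintegral_ofReal ((integrable_exp_mul_gaussianReal b).const_mul _)
    (ae_of_all _ fun _ => by positivity), integral_const_mul, hmgf]

lemma lintegral_exp_add_mul_rademacher_le_gaussianReal (a b : ℝ) :
    ∫⁻ t, ENNReal.ofReal (Real.exp (a + t * b)) ∂rademacher
      ≤ ∫⁻ t, ENNReal.ofReal (Real.exp (a + t * b)) ∂gaussianReal 0 1 := by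
  rw [lintegral_exp_add_mul_rademacher, lintegral_exp_add_mul_gaussianReal]
  gcongr
  exact Real.cosh_le_exp_half_sq b

lemma lintegral_exp_dotProduct_mulVec_rademacher_le_gaussianReal {ι : Type*} [Fintype ι]
    {B : Matrix ι ι ℝ} (hB : ∀ i, B i i = 0) :
    ∫⁻ x, ENNReal.ofReal (Real.exp (x ⬝ᵥ B *ᵥ x)) ∂Measure.pi (fun _ : ι => rademacher)
      ≤ ∫⁻ x, ENNReal.ofReal (Real.exp (x ⬝ᵥ B *ᵥ x))
          ∂Measure.pi (fun _ : ι => gaussianReal 0 1) := by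
  classical
  refine lintegral_pi_mono_of_update (measurable_dotProduct_mulVec B).exp.ennreal_ofReal
    fun i x => ?_
  have haffine := fun t => congrArg (fun r => ENNReal.ofReal (Real.exp r))
    (dotProduct_mulVec_update (hB i) x t)
  rw [lintegral_congr haffine, lintegral_congr haffine]
  exact lintegral_exp_add_mul_rademacher_le_gaussianReal _ _

end Rademacher

section RademacherChaos

/-- The homogeneous chaos of order two `∑ i, ∑ j, B i j * X i * X j` in the random variables `X i`:
the random variable whose tails are to be bounded. -/
def quadraticChaos {ι Ω : Type*} [Fintype ι] (B : Matrix ι ι ℝ) (X : ι → Ω → ℝ) (ω : Ω) : ℝ :=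
  (fun i => X i ω) ⬝ᵥ B *ᵥ fun i => X i ω

variable {ι Ω : Type*} {X : ι → Ω → ℝ}

section Algebra

variable [Fintype ι]

lemma quadraticChaos_smul (t : ℝ) (B : Matrix ι ι ℝ) (X : ι → Ω → ℝ) (ω : Ω) :
    quadraticChaos (t • B) X ω = t * quadraticChaos B X ω := by
  rw [quadraticChaos, Matrix.smul_mulVec, dotProduct_smul, smul_eq_mul, quadraticChaos]

lemma quadraticChaos_neg (B : Matrix ι ι ℝ) (X : ι → Ω → ℝ) :
    quadraticChaos (-B) X = -quadraticChaos B X := by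
  funext ω
  rw [quadraticChaos, Matrix.neg_mulVec, dotProduct_neg, Pi.neg_apply, quadraticChaos]

end Algebra

variable [MeasurableSpace Ω] {μ : Measure Ω}

namespace IsRademacherFamily

lemma comp_injective (hX : IsRademacherFamily X μ) {κ : Type*} {g : κ → ι} (hg : g.Injective) :
    IsRademacherFamily (fun k => X (g k)) μ :=
  ⟨fun k => hX.hasLaw (g k), hX.indep.precomp hg⟩

lemma aemeasurable (hX : IsRademacherFamily X μ) (i : ι) : AEMeasurable (X i) μ :=
  (hX.hasLaw i).aemeasurable

lemma ae_eq_one_or_eq_neg_one (hX : IsRademacherFamily X μ) (i : ι) :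
    ∀ᵐ ω ∂μ, X i ω = 1 ∨ X i ω = -1 := by
  refine ae_of_ae_map (p := fun t => t = 1 ∨ t = -1) (hX.aemeasurable i) ?_
  rw [(hX.hasLaw i).map_eq]
  exact ae_rademacher

lemma integral_pow (hX : IsRademacherFamily X μ) (i : ι) (e : ℕ) :
    ∫ ω, X i ω ^ e ∂μ = if Even e then 1 else 0 := by
  rw [← integral_pow_rademacher]
  exact (hX.hasLaw i).integral_comp (f := fun t => t ^ e) (by fun_prop)

lemma integral_prod_pow (hX : IsRademacherFamily X μ) (s : Finset ι) (e : ι → ℕ) :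
    ∫ ω, ∏ i ∈ s, X i ω ^ e i ∂μ = if ∀ i ∈ s, Even (e i) then 1 else 0 := by
  have hs : IsRademacherFamily (fun i : s => X i) μ := hX.comp_injective Subtype.val_injective
  simp_rw [← Finset.prod_coe_sort s]
  rw [hs.indep.integral_fun_prod_comp (f := fun (i : s) t => t ^ e i) hs.aemeasurable
    (fun i => by fun_prop)]
  simp_rw [hX.integral_pow]
  rw [Finset.prod_coe_sort s fun i => if Even (e i) then (1 : ℝ) else 0, Finset.prod_boole]

lemma integral_multiset_prod [DecidableEq ι] (hX : IsRademacherFamily X μ) (s : Multiset ι) :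
    ∫ ω, (s.map fun i => X i ω).prod ∂μ = if ∀ i ∈ s, Even (s.count i) then 1 else 0 := by
  simpa only [Finset.prod_multiset_map_count, Multiset.mem_toFinset]
    using hX.integral_prod_pow s.toFinset fun i => s.count i

lemma integral_mul (hX : IsRademacherFamily X μ) {i j : ι} (hij : i ≠ j) :
    ∫ ω, X i ω * X j ω ∂μ = 0 := by
  classical
  have hodd : ¬∀ a ∈ ({i, j} : Multiset ι), Even (Multiset.count a {i, j}) := fun h => by
    simpa [Multiset.count_cons, Multiset.count_singleton, hij] using h i (by simp)
  have h := hX.integral_multiset_prod {i, j}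
  rw [if_neg hodd] at h
  simpa using h

end IsRademacherFamily

lemma forall_even_count_iff [DecidableEq ι] {i j k l : ι} (hij : i ≠ j) :
    (∀ a ∈ ({i, j, k, l} : Multiset ι), Even (Multiset.count a {i, j, k, l})) ↔
      k = i ∧ l = j ∨ k = j ∧ l = i := by
  have hcount : ∀ a, Multiset.count a {i, j, k, l} = (if a = i then 1 else 0)
      + (if a = j then 1 else 0) + (if a = k then 1 else 0) + (if a = l then 1 else 0) := by
    intro a
    simp only [Multiset.insert_eq_cons, Multiset.count_cons, Multiset.count_singleton]
    ring
  simp_rw [hcount]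
  constructor
  · intro h
    have hi := h i (by simp)
    have hj := h j (by simp)
    grind
  · rintro (⟨rfl, rfl⟩ | ⟨rfl, rfl⟩) a - <;> grind

namespace IsRademacherFamily

lemma integral_mul_mul_mul [DecidableEq ι] (hX : IsRademacherFamily X μ) {i j k l : ι}
    (hij : i ≠ j) :
    ∫ ω, X i ω * X j ω * (X k ω * X l ω) ∂μ
      = if k = i ∧ l = j ∨ k = j ∧ l = i then 1 else 0 := by
  have h := hX.integral_multiset_prod {i, j, k, l}
  simp_rw [forall_even_count_iff hij] at h
  simpa only [Multiset.insert_eq_cons, Multiset.map_cons, Multiset.map_singleton,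
    Multiset.prod_cons, Multiset.prod_singleton, mul_assoc] using h

lemma memLp_mul [IsFiniteMeasure μ] (hX : IsRademacherFamily X μ) (i j : ι)
    (p : ℝ≥0∞) : MemLp (fun ω => X i ω * X j ω) p μ := by
  refine MemLp.of_bound
    ((hX.aemeasurable i).mul (hX.aemeasurable j)).aestronglyMeasurable 1 ?_
  filter_upwards [hX.ae_eq_one_or_eq_neg_one i, hX.ae_eq_one_or_eq_neg_one j] with ω hi hj
  rcases hi with hi | hi <;> rcases hj with hj | hj <;> simp [hi, hj]

lemma covariance_mul_mul [DecidableEq ι] [IsProbabilityMeasure μ] (hX : IsRademacherFamily X μ)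
    {i j k l : ι} (hij : i ≠ j) :
    cov[fun ω => X i ω * X j ω, fun ω => X k ω * X l ω; μ]
      = if k = i ∧ l = j ∨ k = j ∧ l = i then 1 else 0 := by
  rw [covariance_eq_sub (hX.memLp_mul i j 2) (hX.memLp_mul k l 2), hX.integral_mul hij, zero_mul,
    sub_zero, ← hX.integral_mul_mul_mul hij]
  rfl

variable [Fintype ι]

lemma variance_quadraticChaos [IsProbabilityMeasure μ] (hX : IsRademacherFamily X μ)
    {B : Matrix ι ι ℝ} (hB : B.IsSymm) (hd : ∀ i, B i i = 0) :
    Var[quadraticChaos B X; μ] = 2 * ∑ i, ∑ j, B i j ^ 2 := by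
  classical
  have hcov : ∀ p q : ι × ι,
      cov[fun ω => B p.1 p.2 * (X p.1 ω * X p.2 ω), fun ω => B q.1 q.2 * (X q.1 ω * X q.2 ω); μ]
        = B p.1 p.2 * ((if q = p then B q.1 q.2 else 0) + if q = p.swap then B q.1 q.2 else 0) := by
    intro p q
    rw [covariance_const_mul_left, covariance_const_mul_right]
    obtain hp | hp := eq_or_ne p.1 p.2
    · rw [hp, hd, zero_mul, zero_mul]
    rw [hX.covariance_mul_mul hp]
    grind
  have hchaos : quadraticChaos B X = fun ω => ∑ p : ι × ι, B p.1 p.2 * (X p.1 ω * X p.2 ω) :=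
    funext fun ω => dotProduct_mulVec_eq_sum B _
  have hmemLp : ∀ p : ι × ι, MemLp (fun ω => B p.1 p.2 * (X p.1 ω * X p.2 ω)) 2 μ := fun p =>
    (hX.memLp_mul p.1 p.2 2).const_mul (B p.1 p.2)
  rw [hchaos, variance_fun_sum hmemLp, Finset.mul_sum]
  simp_rw [hcov, ← Finset.mul_sum, Finset.sum_add_distrib, Finset.sum_ite_eq', Finset.mem_univ,
    if_true, Prod.fst_swap, Prod.snd_swap, Fintype.sum_prod_type, hB.apply, Finset.mul_sum]
  exact Finset.sum_congr rfl fun i _ => Finset.sum_congr rfl fun j _ => by ring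

lemma aemeasurable_quadraticChaos (hX : IsRademacherFamily X μ) (B : Matrix ι ι ℝ) :
    AEMeasurable (quadraticChaos B X) μ :=
  (measurable_dotProduct_mulVec B).comp_aemeasurable (aemeasurable_pi_lambda _ hX.aemeasurable)

lemma lintegral_exp_quadraticChaos_le (hX : IsRademacherFamily X μ) {B : Matrix ι ι ℝ}
    (hB : B.IsSymm) (hd : ∀ i, B i i = 0) {κ : ℝ}
    (hκB : ∀ x : ι → ℝ, x ⬝ᵥ B *ᵥ x ≤ κ * (x ⬝ᵥ x)) (hκ : 2 * κ < 1) :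
    ∫⁻ ω, ENNReal.ofReal (Real.exp (quadraticChaos B X ω)) ∂μ
      ≤ ENNReal.ofReal (Real.exp (2 * (∑ i, ∑ j, B i j ^ 2) / (1 - 2 * κ))) := by
  have hHerm : B.IsHermitian := by
    rwa [Matrix.IsHermitian, Matrix.conjTranspose_eq_transpose_of_trivial]
  have htrace : B.trace = 0 := by simp [Matrix.trace, hd]
  calc ∫⁻ ω, ENNReal.ofReal (Real.exp (quadraticChaos B X ω)) ∂μ
      = ∫⁻ x, ENNReal.ofReal (Real.exp (x ⬝ᵥ B *ᵥ x)) ∂Measure.pi (fun _ : ι => rademacher) :=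
        (hX.indep.hasLaw_pi hX.hasLaw).lintegral_comp
          (measurable_dotProduct_mulVec B).exp.ennreal_ofReal.aemeasurable
    _ ≤ ∫⁻ x, ENNReal.ofReal (Real.exp (x ⬝ᵥ B *ᵥ x))
          ∂Measure.pi (fun _ : ι => gaussianReal 0 1) :=
        lintegral_exp_dotProduct_mulVec_rademacher_le_gaussianReal hd
    _ ≤ ENNReal.ofReal (Real.exp (2 * (∑ i, ∑ j, B i j ^ 2) / (1 - 2 * κ))) := by
        simpa only [htrace, zero_add]
          using lintegral_exp_dotProduct_mulVec_gaussianReal_le hHerm hκB hκ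

lemma hasSubgammaMGF_quadraticChaos (hX : IsRademacherFamily X μ) {B : Matrix ι ι ℝ}
    (hB : B.IsSymm) (hd : ∀ i, B i i = 0) {κ : ℝ}
    (hκB : ∀ x : ι → ℝ, x ⬝ᵥ B *ᵥ x ≤ κ * (x ⬝ᵥ x)) :
    HasSubgammaMGF (quadraticChaos B X) (4 * ∑ i, ∑ j, B i j ^ 2) (2 * κ) μ := by
  have hlintegral : ∀ t, 0 ≤ t → 2 * κ * t < 1 →
      ∫⁻ ω, ENNReal.ofReal (Real.exp (t * quadraticChaos B X ω)) ∂μ ≤ ENNReal.ofReal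
        (Real.exp (4 * (∑ i, ∑ j, B i j ^ 2) * t ^ 2 / (2 * (1 - 2 * κ * t)))) := by
    intro t ht hκt
    have hκ_smul : ∀ x : ι → ℝ, x ⬝ᵥ (t • B) *ᵥ x ≤ t * κ * (x ⬝ᵥ x) := fun x => by
      rw [Matrix.smul_mulVec, dotProduct_smul, smul_eq_mul, mul_assoc]
      exact mul_le_mul_of_nonneg_left (hκB x) ht
    simp_rw [← quadraticChaos_smul]
    refine (hX.lintegral_exp_quadraticChaos_le (hB.smul t) (by simp [hd]) hκ_smul
      (by linarith)).trans_eq ?_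
    simp_rw [Matrix.smul_apply, smul_eq_mul, mul_pow, ← Finset.mul_sum]
    congr 2
    rw [← mul_div_mul_left _ _ (two_ne_zero' ℝ)]
    ring
  have hmeas : ∀ t, AEStronglyMeasurable (fun ω => Real.exp (t * quadraticChaos B X ω)) μ :=
    fun t => ((hX.aemeasurable_quadraticChaos B).const_mul t).exp.aestronglyMeasurable
  have hnonneg : ∀ t, 0 ≤ᵐ[μ] fun ω => Real.exp (t * quadraticChaos B X ω) :=
    fun t => ae_of_all _ fun _ => (Real.exp_pos _).le
  refine ⟨fun t ht hκt => ⟨hmeas t, ?_⟩, fun t ht hκt => ?_⟩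
  · rw [hasFiniteIntegral_iff_ofReal (hnonneg t)]
    exact (hlintegral t ht hκt).trans_lt ENNReal.ofReal_lt_top
  · rw [mgf, integral_eq_lintegral_of_nonneg_ae (hnonneg t) (hmeas t)]
    exact ENNReal.toReal_le_of_le_ofReal (Real.exp_pos _).le (hlintegral t ht hκt)

lemma hasSubgammaMGF_neg_quadraticChaos (hX : IsRademacherFamily X μ) {B : Matrix ι ι ℝ}
    (hB : B.IsSymm) (hd : ∀ i, B i i = 0) {κ : ℝ}
    (hκB : ∀ x : ι → ℝ, -(κ * (x ⬝ᵥ x)) ≤ x ⬝ᵥ B *ᵥ x) :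
    HasSubgammaMGF (-quadraticChaos B X) (4 * ∑ i, ∑ j, B i j ^ 2) (2 * κ) μ := by
  have h : HasSubgammaMGF (quadraticChaos (-B) X) (4 * ∑ i, ∑ j, (-B) i j ^ 2) (2 * κ) μ :=
    hX.hasSubgammaMGF_quadraticChaos hB.neg (by simp [hd]) fun x => by
      rw [Matrix.neg_mulVec, dotProduct_neg]
      exact neg_le.1 (hκB x)
  simpa only [quadraticChaos_neg, Matrix.neg_apply, neg_sq] using h

lemma measureReal_abs_quadraticChaos_ge_le [IsFiniteMeasure μ] (hX : IsRademacherFamily X μ)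
    {B : Matrix ι ι ℝ} (hB : B.IsSymm) (hd : ∀ i, B i i = 0) {κ : ℝ} (hκ : 0 ≤ κ)
    (hκB : ∀ x : ι → ℝ, |x ⬝ᵥ B *ᵥ x| ≤ κ * (x ⬝ᵥ x)) {ε : ℝ} (hε : 0 ≤ ε)
    (hD : 0 < 8 * (∑ i, ∑ j, B i j ^ 2) + 4 * ε * κ) :
    μ.real {ω | ε ≤ |quadraticChaos B X ω|}
      ≤ 2 * Real.exp (-(ε ^ 2 / (8 * (∑ i, ∑ j, B i j ^ 2) + 4 * ε * κ))) := by
  have h := hX.hasSubgammaMGF_quadraticChaos hB hd fun x => (abs_le.1 (hκB x)).2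
  have hneg := hX.hasSubgammaMGF_neg_quadraticChaos hB hd fun x => (abs_le.1 (hκB x)).1
  convert h.measureReal_abs_ge_le hneg (by positivity) (by positivity) hε (by linarith) using 5
  ring

end IsRademacherFamily

end RademacherChaos

section MatrixNorms

variable {ι : Type*}

lemma offDiag_apply [DecidableEq ι] (B : Matrix ι ι ℝ) (i j : ι) :
    offDiag B i j = if i = j then 0 else B i j := by
  obtain rfl | hij := eq_or_ne i j <;> simp [offDiag, *]

lemma isSymm_offDiag [DecidableEq ι] {B : Matrix ι ι ℝ} (hB : B.IsSymm) : (offDiag B).IsSymm :=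
  hB.sub (Matrix.isSymm_diagonal _)

variable [Fintype ι]

lemma dotProduct_mulVec_eq_offDiag_add_trace [DecidableEq ι] (B : Matrix ι ι ℝ) {x : ι → ℝ}
    (hx : ∀ i, x i = 1 ∨ x i = -1) :
    x ⬝ᵥ B *ᵥ x = x ⬝ᵥ offDiag B *ᵥ x + B.trace := by
  have hsign : ∀ i, x i * (B i i * x i) = B i i := fun i => by
    rcases hx i with h | h <;> simp [h]
  have hdiag : x ⬝ᵥ Matrix.diagonal B.diag *ᵥ x = B.trace := by
    simp [dotProduct, Matrix.mulVec_diagonal, Matrix.trace, hsign]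
  rw [offDiag, Matrix.sub_mulVec, dotProduct_sub, hdiag, sub_add_cancel]

lemma frobNorm_sq (B : Matrix ι ι ℝ) : frobNorm B ^ 2 = ∑ i, ∑ j, B i j ^ 2 := by
  rw [frobNorm, Matrix.frobenius_norm_def, ← Real.sqrt_eq_rpow, Real.sq_sqrt (by positivity)]
  simp

lemma abs_dotProduct_mulVec_le [DecidableEq ι] (B : Matrix ι ι ℝ) (x : ι → ℝ) :
    |x ⬝ᵥ B *ᵥ x| ≤ specNorm B * (x ⬝ᵥ x) := by
  set T := Matrix.toEuclideanCLM (n := ι) (𝕜 := ℝ) B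
  set v := WithLp.toLp 2 x
  have hform : inner ℝ v (T v) = x ⬝ᵥ B *ᵥ x := by
    rw [Matrix.toEuclideanCLM_toLp, EuclideanSpace.inner_toLp_toLp, star_trivial, dotProduct_comm]
  have hnorm : ‖v‖ * ‖v‖ = x ⬝ᵥ x := by
    rw [← real_inner_self_eq_norm_mul_norm, EuclideanSpace.inner_toLp_toLp, star_trivial]
  calc |x ⬝ᵥ B *ᵥ x| = |inner ℝ v (T v)| := by rw [hform]
    _ ≤ ‖v‖ * ‖T v‖ := abs_real_inner_le_norm _ _
    _ ≤ ‖v‖ * (‖T‖ * ‖v‖) := by gcongr; exact T.le_opNorm v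
    _ = specNorm B * (x ⬝ᵥ x) := by rw [← hnorm, specNorm]; ring

end MatrixNorms

section BlockDiagonal

open scoped Kronecker

variable {ι κ : Type*} [Fintype ι] [DecidableEq ι] [Fintype κ]
  {α : ι → Type*} [∀ i, Fintype (α i)]

lemma dotProduct_blockDiagonal'_mulVec {R : Type*} [NonUnitalNonAssocSemiring R]
    (M : ∀ i, Matrix (α i) (α i) R) (x : (Σ i, α i) → R) :
    x ⬝ᵥ Matrix.blockDiagonal' M *ᵥ x
      = ∑ i, (fun a => x ⟨i, a⟩) ⬝ᵥ M i *ᵥ (fun a => x ⟨i, a⟩) := by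
  simp only [dotProduct, Matrix.mulVec, Fintype.sum_sigma]
  refine Finset.sum_congr rfl fun i _ => Finset.sum_congr rfl fun a _ => ?_
  rw [Fintype.sum_eq_single i fun j hj => Finset.sum_eq_zero fun b _ => by
    rw [Matrix.blockDiagonal'_apply_ne _ _ _ hj.symm, zero_mul]]
  simp only [Matrix.blockDiagonal'_apply_eq]

lemma sum_sq_blockDiagonal' {R : Type*} [Semiring R] (M : ∀ i, Matrix (α i) (α i) R) :
    ∑ p, ∑ q, Matrix.blockDiagonal' M p q ^ 2 = ∑ i, ∑ a, ∑ b, M i a b ^ 2 := by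
  simp only [Fintype.sum_sigma]
  refine Finset.sum_congr rfl fun i _ => Finset.sum_congr rfl fun a _ => ?_
  rw [Fintype.sum_eq_single i fun j hj => Finset.sum_eq_zero fun b _ => by
    rw [Matrix.blockDiagonal'_apply_ne _ _ _ hj.symm, zero_pow two_ne_zero]]
  simp only [Matrix.blockDiagonal'_apply_eq]

lemma abs_dotProduct_blockDiagonal'_mulVec_le {M : ∀ i, Matrix (α i) (α i) ℝ} {c : ℝ}
    (hM : ∀ i y, |y ⬝ᵥ M i *ᵥ y| ≤ c * (y ⬝ᵥ y)) (x : (Σ i, α i) → ℝ) :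
    |x ⬝ᵥ Matrix.blockDiagonal' M *ᵥ x| ≤ c * (x ⬝ᵥ x) := by
  have hx : x ⬝ᵥ x = ∑ i, (fun a => x ⟨i, a⟩) ⬝ᵥ (fun a => x ⟨i, a⟩) := by
    simp only [dotProduct, Fintype.sum_sigma]
  rw [dotProduct_blockDiagonal'_mulVec, hx, Finset.mul_sum]
  exact (Finset.abs_sum_le_sum_abs _ _).trans (Finset.sum_le_sum fun i _ => hM i _)

lemma dotProduct_one_kronecker_mulVec {R : Type*} [NonAssocSemiring R] (K : Matrix κ κ R)
    (x : ι × κ → R) :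
    x ⬝ᵥ ((1 : Matrix ι ι R) ⊗ₖ K) *ᵥ x
      = ∑ s, (fun a => x (s, a)) ⬝ᵥ K *ᵥ (fun a => x (s, a)) := by
  simp only [dotProduct, Matrix.mulVec, Fintype.sum_prod_type, Matrix.kroneckerMap_apply,
    Matrix.one_apply, ite_mul, one_mul, zero_mul]
  refine Finset.sum_congr rfl fun s _ => Finset.sum_congr rfl fun a _ => ?_
  rw [Finset.sum_comm]
  simp

lemma sum_sq_one_kronecker {R : Type*} [Semiring R] (K : Matrix κ κ R) :
    ∑ p, ∑ q, ((1 : Matrix ι ι R) ⊗ₖ K) p q ^ 2 = Fintype.card ι * ∑ a, ∑ b, K a b ^ 2 := by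
  simp only [Fintype.sum_prod_type, Matrix.kroneckerMap_apply, Matrix.one_apply, ite_mul, one_mul,
    zero_mul, ite_pow]
  simp

lemma abs_dotProduct_one_kronecker_mulVec_le {K : Matrix κ κ ℝ} {c : ℝ}
    (hK : ∀ y, |y ⬝ᵥ K *ᵥ y| ≤ c * (y ⬝ᵥ y)) (x : ι × κ → ℝ) :
    |x ⬝ᵥ ((1 : Matrix ι ι ℝ) ⊗ₖ K) *ᵥ x| ≤ c * (x ⬝ᵥ x) := by
  have hx : x ⬝ᵥ x = ∑ s, (fun a => x (s, a)) ⬝ᵥ (fun a => x (s, a)) := by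
    simp only [dotProduct, Fintype.sum_prod_type]
  rw [dotProduct_one_kronecker_mulVec, hx, Finset.mul_sum]
  exact (Finset.abs_sum_le_sum_abs _ _).trans (Finset.sum_le_sum fun s _ => hK _)

end BlockDiagonal

section ErrorMatrix

open scoped Kronecker

variable {n m : ℕ} (M : Matrix (Fin n) (Fin n) ℝ) (col : Fin n → Fin m) (N : Fin m → ℕ)

variable {M} in
lemma isSymm_colorBlock (hM : M.IsSymm) (ℓ : Fin m) : (colorBlock M col ℓ).IsSymm :=
  hM.submatrix _

/-- The block-diagonal matrix with `N ℓ` blocks `(1 / N ℓ) Off([M]_{C_ℓ})` for each color `ℓ`. Its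
quadratic form in the random signs is, up to sign, the error of the probing estimator. -/
noncomputable def errorMatrix : Matrix (SignIndex col N) (SignIndex col N) ℝ :=
  Matrix.blockDiagonal' fun ℓ => (1 / (N ℓ : ℝ)) •
    ((1 : Matrix (Fin (N ℓ)) (Fin (N ℓ)) ℝ) ⊗ₖ offDiag (colorBlock M col ℓ))

lemma dotProduct_errorMatrix_mulVec (x : SignIndex col N → ℝ) :
    x ⬝ᵥ errorMatrix M col N *ᵥ x = ∑ ℓ, (1 / (N ℓ : ℝ)) * ∑ s : Fin (N ℓ),
      (fun i => x ⟨ℓ, s, i⟩) ⬝ᵥ offDiag (colorBlock M col ℓ) *ᵥ (fun i => x ⟨ℓ, s, i⟩) := by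
  simp only [errorMatrix, dotProduct_blockDiagonal'_mulVec, Matrix.smul_mulVec, dotProduct_smul,
    dotProduct_one_kronecker_mulVec, smul_eq_mul]

lemma errorMatrix_apply_self (k : SignIndex col N) : errorMatrix M col N k k = 0 := by
  simp [errorMatrix, Matrix.blockDiagonal'_apply, offDiag_apply]

variable {M} in
lemma isSymm_errorMatrix (hM : M.IsSymm) : (errorMatrix M col N).IsSymm := by
  rw [Matrix.IsSymm, errorMatrix, Matrix.blockDiagonal'_transpose]
  congr 1
  funext ℓ
  rw [Matrix.transpose_smul, ← Matrix.kroneckerMap_transpose, Matrix.transpose_one,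
    (isSymm_offDiag (isSymm_colorBlock col hM ℓ)).eq]

variable {N} in
lemma sum_sq_errorMatrix (hN : ∀ ℓ, 0 < N ℓ) :
    ∑ p, ∑ q, errorMatrix M col N p q ^ 2 = etaOne M col N := by
  rw [errorMatrix, sum_sq_blockDiagonal', etaOne]
  refine Finset.sum_congr rfl fun ℓ _ => ?_
  have : (N ℓ : ℝ) ≠ 0 := Nat.cast_ne_zero.2 (hN ℓ).ne'
  simp only [Matrix.smul_apply, smul_eq_mul, mul_pow, ← Finset.mul_sum]
  rw [sum_sq_one_kronecker, frobNorm_sq, Fintype.card_fin]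
  field_simp

lemma etaOne_nonneg : 0 ≤ etaOne M col N :=
  Finset.sum_nonneg fun _ _ => by positivity

lemma etaTwo_nonneg : 0 ≤ etaTwo M col N :=
  Real.iSup_nonneg fun _ => mul_nonneg (by positivity) (norm_nonneg _)

variable {M col N} in
lemma errorMatrix_eq_zero (hN : ∀ ℓ, 0 < N ℓ) (h : etaOne M col N = 0) :
    errorMatrix M col N = 0 := by
  ext p q
  rw [← sum_sq_errorMatrix M col hN,
    Finset.sum_eq_zero_iff_of_nonneg fun _ _ => by positivity] at h
  have hrow := (Finset.sum_eq_zero_iff_of_nonneg fun _ _ => sq_nonneg _).1 (h p (Finset.mem_univ p))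
  exact sq_eq_zero_iff.1 (hrow q (Finset.mem_univ q))

lemma abs_dotProduct_errorMatrix_mulVec_le (x : SignIndex col N → ℝ) :
    |x ⬝ᵥ errorMatrix M col N *ᵥ x| ≤ etaTwo M col N * (x ⬝ᵥ x) := by
  refine abs_dotProduct_blockDiagonal'_mulVec_le (fun ℓ y => ?_) x
  have hy : 0 ≤ y ⬝ᵥ y := Finset.sum_nonneg fun i _ => mul_self_nonneg _
  rw [Matrix.smul_mulVec, dotProduct_smul, smul_eq_mul, abs_mul, abs_of_nonneg (by positivity)]
  calc 1 / (N ℓ : ℝ) * |y ⬝ᵥ ((1 : Matrix _ _ ℝ) ⊗ₖ offDiag (colorBlock M col ℓ)) *ᵥ y|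
      ≤ 1 / (N ℓ : ℝ) * (specNorm (offDiag (colorBlock M col ℓ)) * (y ⬝ᵥ y)) := by
        gcongr
        exact abs_dotProduct_one_kronecker_mulVec_le (abs_dotProduct_mulVec_le _) y
    _ = 1 / (N ℓ : ℝ) * specNorm (offDiag (colorBlock M col ℓ)) * (y ⬝ᵥ y) :=
        (mul_assoc _ _ _).symm
    _ ≤ etaTwo M col N * (y ⬝ᵥ y) := by
        gcongr
        exact le_ciSup (f := fun ℓ => 1 / (N ℓ : ℝ) * specNorm (offDiag (colorBlock M col ℓ)))
          (Set.finite_range _).bddAbove ℓ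

end ErrorMatrix

section Estimator

variable {n m : ℕ} {M : Matrix (Fin n) (Fin n) ℝ} {col : Fin n → Fin m} {N : Fin m → ℕ}

variable (M) in
lemma probingForm_eq_dotProduct_colorBlock_mulVec (x : SignIndex col N → ℝ) (ℓ : Fin m)
    (s : Fin (N ℓ)) :
    probingForm M col N x ℓ s
      = (fun i => x ⟨ℓ, s, i⟩) ⬝ᵥ colorBlock M col ℓ *ᵥ (fun i => x ⟨ℓ, s, i⟩) := by
  simp only [probingForm, probingVector, Matrix.mulVec_sum, sum_dotProduct, dotProduct_sum,
    Matrix.mulVec_smul, smul_dotProduct, dotProduct_smul, Matrix.mulVec_single_one,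
    single_one_dotProduct, smul_eq_mul, Matrix.col_apply]
  simp only [dotProduct, Matrix.mulVec, Finset.mul_sum, colorBlock, Matrix.submatrix_apply]
  rw [Finset.sum_comm]
  exact Finset.sum_congr rfl fun i _ => Finset.sum_congr rfl fun j _ => by ring

variable (M col) in
lemma sum_trace_colorBlock : ∑ ℓ, (colorBlock M col ℓ).trace = M.trace :=
  Fintype.sum_fiberwise col fun i => M i i

variable (M) in
lemma trace_sub_probingEstimator (hN : ∀ ℓ, 0 < N ℓ) {x : SignIndex col N → ℝ}
    (hx : ∀ k, x k = 1 ∨ x k = -1) :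
    M.trace - probingEstimator M col N x = -(x ⬝ᵥ errorMatrix M col N *ᵥ x) := by
  have hcolor : ∀ ℓ, (1 / (N ℓ : ℝ)) * ∑ s : Fin (N ℓ), probingForm M col N x ℓ s
      = (1 / (N ℓ : ℝ)) * ∑ s : Fin (N ℓ), (fun i => x ⟨ℓ, s, i⟩) ⬝ᵥ
        offDiag (colorBlock M col ℓ) *ᵥ (fun i => x ⟨ℓ, s, i⟩) + (colorBlock M col ℓ).trace := by
    intro ℓ
    have : (N ℓ : ℝ) ≠ 0 := Nat.cast_ne_zero.2 (hN ℓ).ne'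
    simp_rw [probingForm_eq_dotProduct_colorBlock_mulVec, dotProduct_mulVec_eq_offDiag_add_trace
      (colorBlock M col ℓ) fun i => hx ⟨ℓ, _, i⟩, Finset.sum_add_distrib, mul_add]
    simp [this]
  rw [probingEstimator, dotProduct_errorMatrix_mulVec, Finset.sum_congr rfl fun ℓ _ => hcolor ℓ,
    Finset.sum_add_distrib, sum_trace_colorBlock]
  ring

lemma two_mul_exp_neg_div_le_of_le_div_log {D q δ : ℝ} (hD : 0 < D) (hq : 0 ≤ q) (hδ : 0 < δ)
    (h : D ≤ q / Real.log (2 / δ)) : 2 * Real.exp (-(q / D)) ≤ δ := by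
  have hlog : Real.log (2 / δ) ≤ q / D := by
    obtain hnonpos | hpos := le_or_gt (Real.log (2 / δ)) 0
    · exact hnonpos.trans (by positivity)
    · exact (le_div_comm₀ hD hpos).1 h
  calc 2 * Real.exp (-(q / D)) ≤ 2 * Real.exp (-Real.log (2 / δ)) := by gcongr
    _ = δ := by
      rw [Real.exp_neg, Real.exp_log (by positivity)]
      field_simp

namespace IsRademacherFamily

variable {Ω : Type*} [MeasurableSpace Ω] {μ : Measure Ω} {X : SignIndex col N → Ω → ℝ}

lemma variance_probingForm [IsProbabilityMeasure μ] (hX : IsRademacherFamily X μ) (hM : M.IsSymm)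
    (ℓ : Fin m) (s : Fin (N ℓ)) :
    Var[fun ω => probingForm M col N (fun k => X k ω) ℓ s; μ]
      = 2 * frobNorm (offDiag (colorBlock M col ℓ)) ^ 2 := by
  have hY : IsRademacherFamily (fun i : ColorClass col ℓ => X ⟨ℓ, s, i⟩) μ :=
    hX.comp_injective (g := fun i => ⟨ℓ, s, i⟩) fun i j h => by simpa using h
  have hae : (fun ω => probingForm M col N (fun k => X k ω) ℓ s) =ᵐ[μ]
      fun ω => quadraticChaos (offDiag (colorBlock M col ℓ)) (fun i => X ⟨ℓ, s, i⟩) ω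
        + (colorBlock M col ℓ).trace := by
    filter_upwards [ae_all_iff.2 hY.ae_eq_one_or_eq_neg_one] with ω hω
    rw [probingForm_eq_dotProduct_colorBlock_mulVec, dotProduct_mulVec_eq_offDiag_add_trace _ hω,
      quadraticChaos]
  rw [variance_congr hae,
    variance_add_const (hY.aemeasurable_quadraticChaos _).aestronglyMeasurable,
    hY.variance_quadraticChaos (isSymm_offDiag (isSymm_colorBlock col hM ℓ))
      (by simp [offDiag_apply]), frobNorm_sq]

lemma etaOne_eq_half_sum_variance [IsProbabilityMeasure μ] (hX : IsRademacherFamily X μ)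
    (hM : M.IsSymm) (s : ∀ ℓ, Fin (N ℓ)) :
    etaOne M col N = (1 / 2) * ∑ ℓ, (1 / (N ℓ : ℝ)) *
      Var[fun ω => probingForm M col N (fun k => X k ω) ℓ (s ℓ); μ] := by
  simp_rw [hX.variance_probingForm hM, etaOne, Finset.mul_sum]
  exact Finset.sum_congr rfl fun ℓ _ => by ring

variable (M) in
lemma measureReal_abs_error_ge_eq (hX : IsRademacherFamily X μ) (hN : ∀ ℓ, 0 < N ℓ) (ε : ℝ) :
    μ.real {ω | ε ≤ |M.trace - probingEstimator M col N (fun k => X k ω)|}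
      = μ.real {ω | ε ≤ |quadraticChaos (errorMatrix M col N) X ω|} := by
  refine measureReal_congr ?_
  filter_upwards [ae_all_iff.2 hX.ae_eq_one_or_eq_neg_one] with ω hω
  have herror : |M.trace - probingEstimator M col N (fun k => X k ω)|
      = |quadraticChaos (errorMatrix M col N) X ω| := by
    rw [trace_sub_probingEstimator M hN hω, abs_neg, quadraticChaos]
  exact propext (by change ε ≤ _ ↔ ε ≤ _; rw [herror])

lemma measureReal_abs_error_ge_eq_zero (hX : IsRademacherFamily X μ) (hN : ∀ ℓ, 0 < N ℓ) {ε : ℝ}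
    (hε : 0 < ε) (hzero : 8 * etaOne M col N + 8 * ε * etaTwo M col N = 0) :
    μ.real {ω | ε ≤ |M.trace - probingEstimator M col N (fun k => X k ω)|} = 0 := by
  have hη₁ : etaOne M col N = 0 := by
    have := mul_nonneg hε.le (etaTwo_nonneg M col N)
    linarith [etaOne_nonneg M col N]
  rw [hX.measureReal_abs_error_ge_eq M hN, errorMatrix_eq_zero hN hη₁]
  simp [quadraticChaos, hε.not_ge]

lemma measureReal_abs_error_ge_le [IsFiniteMeasure μ] (hX : IsRademacherFamily X μ)
    (hN : ∀ ℓ, 0 < N ℓ) (hM : M.IsSymm) {ε : ℝ} (hε : 0 < ε) :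
    μ.real {ω | ε ≤ |M.trace - probingEstimator M col N (fun k => X k ω)|}
      ≤ 2 * Real.exp (-(ε ^ 2 / (8 * etaOne M col N + 8 * ε * etaTwo M col N))) := by
  have hη₁ := etaOne_nonneg M col N
  have hη₂ := mul_nonneg hε.le (etaTwo_nonneg M col N)
  obtain hzero | hpos := (by linarith :
    0 ≤ 8 * etaOne M col N + 8 * ε * etaTwo M col N).eq_or_lt
  · rw [hX.measureReal_abs_error_ge_eq_zero hN hε hzero.symm]
    positivity
  have hD : 0 < 8 * etaOne M col N + 4 * ε * etaTwo M col N := by linarith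
  calc μ.real {ω | ε ≤ |M.trace - probingEstimator M col N (fun k => X k ω)|}
      ≤ 2 * Real.exp (-(ε ^ 2 / (8 * etaOne M col N + 4 * ε * etaTwo M col N))) := by
        rw [← sum_sq_errorMatrix M col hN] at hD ⊢
        rw [hX.measureReal_abs_error_ge_eq M hN]
        exact hX.measureReal_abs_quadraticChaos_ge_le (isSymm_errorMatrix col N hM)
          (errorMatrix_apply_self M col N) (etaTwo_nonneg M col N)
          (abs_dotProduct_errorMatrix_mulVec_le M col N) hε.le hD
    _ ≤ 2 * Real.exp (-(ε ^ 2 / (8 * etaOne M col N + 8 * ε * etaTwo M col N))) := by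
        gcongr 2 * Real.exp (-(ε ^ 2 / ?_))
        linarith

lemma measureReal_abs_error_ge_le_of_le_div_log [IsFiniteMeasure μ]
    (hX : IsRademacherFamily X μ) (hN : ∀ ℓ, 0 < N ℓ) (hM : M.IsSymm) {ε : ℝ} (hε : 0 < ε)
    {δ : ℝ} (hδ : 0 < δ)
    (h : etaOne M col N + ε * etaTwo M col N ≤ ε ^ 2 / (8 * Real.log (2 / δ))) :
    μ.real {ω | ε ≤ |M.trace - probingEstimator M col N (fun k => X k ω)|} ≤ δ := by
  have hD : 0 ≤ 8 * etaOne M col N + 8 * ε * etaTwo M col N := by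
    have := etaOne_nonneg M col N
    have := etaTwo_nonneg M col N
    positivity
  obtain hzero | hpos := hD.eq_or_lt
  · rw [hX.measureReal_abs_error_ge_eq_zero hN hε hzero.symm]
    exact hδ.le
  · refine (hX.measureReal_abs_error_ge_le hN hM hε).trans
      (two_mul_exp_neg_div_le_of_le_div_log hpos (sq_nonneg ε) hδ ?_)
    rw [mul_comm (8 : ℝ), ← div_div] at h
    linarith

end IsRademacherFamily

end Estimator

lemma isSymm_cfc {ι : Type*} [Fintype ι] [DecidableEq ι] (f : ℝ → ℝ) (A : Matrix ι ι ℝ) :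
    (cfc f A).IsSymm := by
  have h : IsSelfAdjoint (cfc f A) := cfc_predicate f A
  rwa [IsSelfAdjoint, Matrix.star_eq_conjTranspose,
    Matrix.conjTranspose_eq_transpose_of_trivial] at h

end StochasticProbing

open StochasticProbing in
theorem mainTheorem4_general {n m : ℕ} {M : Matrix (Fin n) (Fin n) ℝ} (hM : M.IsSymm)
    {col : Fin n → Fin m} {N : Fin m → ℕ} (hN : ∀ ℓ, 0 < N ℓ)
    {Ω : Type*} [MeasurableSpace Ω] {μ : Measure Ω} [IsProbabilityMeasure μ]
    {X : SignIndex col N → Ω → ℝ} (hX : IsRademacherFamily X μ) :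
    (∀ s : (ℓ : Fin m) → Fin (N ℓ), etaOne M col N = (1 / 2) * ∑ ℓ : Fin m, (1 / (N ℓ : ℝ)) *
      Var[fun ω => probingForm M col N (fun k => X k ω) ℓ (s ℓ); μ]) ∧
    ∀ ε : ℝ, 0 < ε →
      μ.real {ω | ε ≤ |M.trace - probingEstimator M col N (fun k => X k ω)|}
        ≤ 2 * Real.exp (-(ε ^ 2 / (8 * etaOne M col N + 8 * ε * etaTwo M col N))) ∧
      (8 * etaOne M col N + 8 * ε * etaTwo M col N = 0 →
        μ.real {ω | ε ≤ |M.trace - probingEstimator M col N (fun k => X k ω)|} = 0) ∧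
      ∀ δ : ℝ, 0 < δ →
        etaOne M col N + ε * etaTwo M col N ≤ ε ^ 2 / (8 * Real.log (2 / δ)) →
        μ.real {ω | ε ≤ |M.trace - probingEstimator M col N (fun k => X k ω)|} ≤ δ :=
  ⟨hX.etaOne_eq_half_sum_variance hM, fun _ hε => ⟨hX.measureReal_abs_error_ge_le hN hM hε,
    hX.measureReal_abs_error_ge_eq_zero hN hε,
    fun _ => hX.measureReal_abs_error_ge_le_of_le_div_log hN hM hε⟩⟩

/-- `cfc f A` is the matrix function `f(A)` of the real symmetric matrix `A`. -/
theorem mainTheorem4 {n m d : ℕ} (A : Matrix (Fin n) (Fin n) ℝ) (hA : A.IsSymm) (f : ℝ → ℝ)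
    (hfA : cfc f A ≠ 0) (col : Fin n → Fin m)
    (hcol : StochasticProbing.IsDistanceColoring (StochasticProbing.matrixGraph A hA) d col)
    (N : Fin m → ℕ) (hN : ∀ ℓ, 0 < N ℓ)
    {Ω : Type*} [MeasurableSpace Ω] (μ : Measure Ω) [IsProbabilityMeasure μ]
    (X : StochasticProbing.SignIndex col N → Ω → ℝ)
    (hX : StochasticProbing.IsRademacherFamily X μ)
    (η₁ η₂ : ℝ) (hη₁ : η₁ = StochasticProbing.etaOne (cfc f A) col N)
    (hη₂ : η₂ = StochasticProbing.etaTwo (cfc f A) col N)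
    (fail : ℝ → ℝ)
    (hfail : ∀ ε, fail ε = μ.real {ω | ε ≤ |(cfc f A).trace -
      StochasticProbing.probingEstimator (cfc f A) col N (fun k => X k ω)|}) :
    -- `η₁` is half of the sum of the `V_ℓ / N_ℓ`, `V_ℓ` the variance of the quadratic form
    (∀ s : (ℓ : Fin m) → Fin (N ℓ), η₁ = (1 / 2) * ∑ ℓ : Fin m, (1 / (N ℓ : ℝ)) *
      Var[fun ω => StochasticProbing.probingForm (cfc f A) col N (fun k => X k ω) ℓ (s ℓ); μ]) ∧
    ∀ ε : ℝ, 0 < ε →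
      fail ε ≤ 2 * Real.exp (-(ε ^ 2 / (8 * η₁ + 8 * ε * η₂))) ∧
      -- the case of a zero denominator, where the bound is read as `0`
      (8 * η₁ + 8 * ε * η₂ = 0 → fail ε = 0) ∧
      ∀ δ : ℝ, 0 < δ → δ ≤ 1 → η₁ + ε * η₂ ≤ ε ^ 2 / (8 * Real.log (2 / δ)) → fail ε ≤ δ := by
  obtain ⟨hvar, htail⟩ := mainTheorem4_general (StochasticProbing.isSymm_cfc f A) hN hX
  subst hη₁ hη₂
  simp only [hfail]
  exact ⟨hvar, fun ε hε => ⟨(htail ε hε).1, (htail ε hε).2.1, fun δ hδ _ => (htail ε hε).2.2 δ hδ⟩⟩
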